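/- A stochastic game $\mathcal G=(V,(V_1,V_2,V_{\mathsf P}),\delta)$ consists of a finite set $V$ of vertices, a partition of $V$ into $V_1,V_2,V_{\mathsf P}$, and a map $\delta:V\times V\to[0,1]$ such that $\delta(v,v')\in\{0,1\}$ for $v\in V_1\cup V_2$, $\delta(v,\cdot)$ is a probability distribution for $v\in V_{\mathsf P}$, and $\mathrm{post}(v)=\{v'\mid\delta(v,v')>0\}\neq\emptyset$ for every $v\in V$. A vertex $v$ is terminal if $\delta(v,v)=1$ and $\delta(v,v')=0$ for all $v'\neq v$; $T$ is the set of terminal vertices. A path is a sequence $\omega\in V^{\mathbb N}$ with $\delta(\omega_k,\omega_{k+1})>0$ for all $k$, and $\inf(\omega)$ is the set of vertices that occur infinitely often in $\omega$. A strategy of Player $i$ ($i\in\{1,2\}$) maps each finite sequence of vertices that ends in a vertex $v\in V_i$ to a probability distribution on $\mathrm{post}(v)$ (it may be randomized and depend on the history). Two strategies $\pi_1,\pi_2$ and an initial vertex $v$ induce a probability measure $\mathrm{Prob}^{\pi_1,\pi_2}_v$ on $V^{\mathbb N}$. A strategy $\pi_2$ of Player 2 is fair if for every strategy $\pi_1$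 of Player 1 and every $v\in V$, $$\mathrm{Prob}^{\pi_1,\pi_2}_v\bigl(\{\omega \text{ a path}\mid \forall v'\in V_2:\ v'\in\inf(\omega)\Rightarrow \mathrm{post}(v')\subseteq\inf(\omega)\}\bigr)=1 .$$ The game is stopping under fairness if for every strategy $\pi_1$ of Player 1, every fair strategy $\pi_2$ of Player 2 and every $v\in V$, $\mathrm{Prob}^{\pi_1,\pi_2}_v(\{\omega\text{ a path}\mid\exists i:\omega_i\in T\})=1$. Consider games with $V=\{0,\dots,n-1\}$, $n\in\mathbb N$, and rational transition probabilities, written as words over a fixed finite alphabet: for each vertex $v$ in turn, a symbol telling which of $V_1,V_2,V_{\mathsf P}$ contains $v$, followed by the list of $\delta(v,0),\dots,\delta(v,n-1)$, each in lowest terms with numerator and denominator in binary. The size of a game is the length of this word. **Theorem.** There are a Turing machine and a polynomial $p$ such that, for every such game $\mathcal G$, the machine started on the word of $\mathcal G$ halts after at most $p(\mathrm{size}(\mathcal G))$ steps and outputs whether $\mathcal G$ is stopping under fairness. That is, whether a stochastic game is stopping under fairness can be decided in time polynomial in the size of the game. -/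

import Mathlib

/-- Who moves at a vertex: Player 1, Player 2, or chance. -/
inductive Owner where
  | player1
  | player2
  | chance
  deriving DecidableEq

/-- A stochastic game `(V, (V₁, V₂, V_P), δ)` on a finite set `V` of vertices. The partition of `V`
is given by the map sending a vertex to the class it belongs to. -/
structure StochasticGame (V : Type*) [Fintype V] where
  owner : V → Owner
  δ : V → V → ℝ
  δ_nonneg : ∀ v w, 0 ≤ δ v w
  δ_le_one : ∀ v w, δ v w ≤ 1
  δ_player : ∀ v, owner v ≠ Owner.chance → ∀ w, δ v w = 0 ∨ δ v w = 1
  δ_chance : ∀ v, owner v = Owner.chance → ∑ w, δ v w = 1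
  exists_succ : ∀ v, ∃ w, 0 < δ v w

namespace StochasticGame

section Definitions

variable {V : Type*} [Fintype V] (G : StochasticGame V)

/-- The set of successors of a vertex. -/
def post (v : V) : Set V := {w | 0 < G.δ v w}

/-- The set of terminal vertices. -/
def terminal : Set V := {v | G.δ v v = 1 ∧ ∀ w, w ≠ v → G.δ v w = 0}

/-- The set of (infinite) paths. -/
def paths : Set (ℕ → V) := {ω | ∀ k, 0 < G.δ (ω k) (ω (k + 1))}

/-- The plays that reach a terminal vertex. -/
def reachTerminal : Set (ℕ → V) := {ω | ω ∈ G.paths ∧ ∃ i, ω i ∈ G.terminal}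

/-- The vertices that occur infinitely often in a sequence. -/
def infOften (ω : ℕ → V) : Set V := {v | ∃ᶠ k in Filter.atTop, ω k = v}

/-- The fair plays for Player 2. -/
def fairPlays : Set (ℕ → V) :=
  {ω | ω ∈ G.paths ∧
    ∀ v, G.owner v = Owner.player2 → v ∈ infOften ω → G.post v ⊆ infOften ω}

/-- A strategy of the player `i`: to a history `h` and a current vertex `v` owned by `i` (together,
a finite sequence of vertices ending in `v`) it assigns a distribution on the successors of `v`. -/
structure Strategy (i : Owner) where
  act : List V → {v : V // G.owner v = i} → PMF V
  act_support : ∀ h v, (act h v).support ⊆ G.post v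

/-- The distribution `δ(v, ·)` at a chance vertex. -/
noncomputable def chanceDist (v : V) (hv : G.owner v = Owner.chance) : PMF V :=
  PMF.ofFintype (fun w => ENNReal.ofReal (G.δ v w)) (by
    rw [← ENNReal.ofReal_sum_of_nonneg (fun w _ => G.δ_nonneg v w), G.δ_chance v hv,
      ENNReal.ofReal_one])

variable {G}

/-- The distribution of the next vertex after the history `h` and the current vertex `v`. -/
noncomputable def nextDist (σ₁ : G.Strategy Owner.player1) (σ₂ : G.Strategy Owner.player2)
    (h : List V) (v : V) : PMF V :=
  match hv : G.owner v with
  | Owner.player1 => σ₁.act h ⟨v, hv⟩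
  | Owner.player2 => σ₂.act h ⟨v, hv⟩
  | Owner.chance => G.chanceDist v hv

variable [MeasurableSpace V] [DiscreteMeasurableSpace V]

/-- The transition kernel from the first `n + 1` vertices `x₀ … xₙ` of a play to the next one. -/
noncomputable def stepKernel (σ₁ : G.Strategy Owner.player1) (σ₂ : G.Strategy Owner.player2)
    (n : ℕ) : ProbabilityTheory.Kernel (Finset.Iic n → V) V where
  toFun x := (nextDist σ₁ σ₂
    (List.ofFn fun i : Fin n => x ⟨i, Finset.mem_Iic.2 i.is_lt.le⟩)
    (x ⟨n, Finset.mem_Iic.2 le_rfl⟩)).toMeasure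
  measurable' := measurable_of_countable _

instance (σ₁ : G.Strategy Owner.player1) (σ₂ : G.Strategy Owner.player2) (n : ℕ) :
    ProbabilityTheory.IsMarkovKernel (stepKernel σ₁ σ₂ n) :=
  ⟨fun _ => PMF.toMeasure.isProbabilityMeasure _⟩

/-- The probability measure on infinite plays that two strategies induce from an initial vertex
(it exists and is unique by the Ionescu-Tulcea theorem). -/
noncomputable def prob (σ₁ : G.Strategy Owner.player1) (σ₂ : G.Strategy Owner.player2) (v : V) :
    MeasureTheory.Measure (ℕ → V) :=
  ProbabilityTheory.Kernel.traj (X := fun _ => V) (stepKernel σ₁ σ₂) 0 (fun _ => v)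

/-- Almost-sure fairness of a strategy of Player 2. -/
def IsFair (σ₂ : G.Strategy Owner.player2) : Prop :=
  ∀ (σ₁ : G.Strategy Owner.player1) (v : V), prob σ₁ σ₂ v G.fairPlays = 1

variable (G) in
/-- Against every fair strategy of Player 2, and for every strategy of Player 1, a terminal vertex
is reached almost surely from every vertex. -/
def StoppingUnderFairness : Prop :=
  ∀ (σ₁ : G.Strategy Owner.player1) (σ₂ : G.Strategy Owner.player2), IsFair σ₂ →
    ∀ v : V, prob σ₁ σ₂ v G.reachTerminal = 1

end Definitions

end StochasticGame

/-- A stochastic game as an input of an algorithm: the vertices are numbered and the transition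
probabilities are rational. -/
structure RationalGame where
  n : ℕ
  game : StochasticGame (Fin n)
  q : Fin n → Fin n → ℚ
  q_eq : ∀ v w, (q v w : ℝ) = game.δ v w

/-- The input alphabet. -/
inductive GameSymbol where
  | owner (o : Owner)
  | bit (b : Bool)
  | slash
  | comma
  deriving DecidableEq

/-- A natural number in binary (least significant bit first). -/
def encodeBinary (k : ℕ) : List GameSymbol := (Computability.encodeNat k).map GameSymbol.bit

/-- A non-negative rational in lowest terms: `numerator / denominator ,`, both in binary. -/
def encodeRat (r : ℚ) : List GameSymbol :=
  encodeBinary r.num.toNat ++ GameSymbol.slash :: (encodeBinary r.den ++ [GameSymbol.comma])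

/-- The row of a vertex: its owner, followed by its transition probabilities. -/
def encodeRow (r : Owner × List ℚ) : List GameSymbol :=
  GameSymbol.owner r.1 :: r.2.flatMap encodeRat

/-- The word that describes a game: the rows of its vertices, one after the other. Its length is
the size of the game. -/
def RationalGame.encode (G : RationalGame) : List GameSymbol :=
  (List.ofFn fun v => (G.game.owner v, List.ofFn (G.q v))).flatMap encodeRow

theorem encodeBinary_injective : Function.Injective encodeBinary := by
  intro a b h
  have h' := List.map_injective_iff.2 (fun x y hxy => by simpa using hxy) h
  rw [← Computability.decode_encodeNat a, h', Computability.decode_encodeNat]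

theorem encodeRat_append_inj {r s : ℚ} (hr : 0 ≤ r) (hs : 0 ≤ s) {u w : List GameSymbol}
    (h : encodeRat r ++ u = encodeRat s ++ w) : r = s ∧ u = w := by
  have hn : ∀ (k : ℕ) (c : GameSymbol), (∀ b, c ≠ GameSymbol.bit b) → c ∉ encodeBinary k := by
    intro k c hc hmem
    obtain ⟨b, -, hb⟩ := List.mem_map.1 hmem
    exact hc b hb.symm
  have split : ∀ (k l : ℕ) (c : GameSymbol), (∀ b, c ≠ GameSymbol.bit b) →
      ∀ u w, encodeBinary k ++ c :: u = encodeBinary l ++ c :: w → k = l ∧ u = w := by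
    intro k l c hc u w huw
    have h1 := congrArg (List.takeWhile (· ≠ c)) huw
    have h2 : ∀ (k : ℕ) (u : List GameSymbol),
        List.takeWhile (· ≠ c) (encodeBinary k ++ c :: u) = encodeBinary k := by
      intro k u
      rw [List.takeWhile_append_of_pos]
      · simp
      · intro a ha
        simpa using fun hac : a = c => hn k c hc (hac ▸ ha)
    rw [h2, h2] at h1
    rw [h1] at huw
    exact ⟨encodeBinary_injective h1, by simpa using huw⟩
  simp only [encodeRat, List.append_assoc, List.cons_append, List.nil_append] at h
  obtain ⟨h5, h2⟩ := split _ _ GameSymbol.slash (by simp) _ _ h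
  obtain ⟨h3, h4⟩ := split _ _ GameSymbol.comma (by simp) _ _ h2
  refine ⟨Rat.ext ?_ h3, h4⟩
  have h6 := Rat.num_nonneg.2 hr
  have h7 := Rat.num_nonneg.2 hs
  omega

theorem flatMap_append_inj {α Γ : Type*} (f : α → List Γ) (P : α → Prop)
    (hf : ∀ a b, P a → P b → ∀ u w, f a ++ u = f b ++ w → a = b ∧ u = w) :
    ∀ (l m : List α), (∀ a ∈ l, P a) → (∀ a ∈ m, P a) → l.length = m.length →
      ∀ u w, l.flatMap f ++ u = m.flatMap f ++ w → l = m ∧ u = w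
  | [], [], _, _, _, u, w, h => ⟨rfl, by simpa using h⟩
  | [], _ :: _, _, _, hl, _, _, _ => by simp at hl
  | _ :: _, [], _, _, hl, _, _, _ => by simp at hl
  | a :: l, b :: m, ha, hb, hl, u, w, h => by
    simp only [List.flatMap_cons, List.append_assoc] at h
    obtain ⟨rfl, h'⟩ := hf a b (ha a (by simp)) (hb b (by simp)) _ _ h
    obtain ⟨rfl, h''⟩ := flatMap_append_inj f P hf l m (fun x hx => ha x (by simp [hx]))
      (fun x hx => hb x (by simp [hx])) (by simpa using hl) u w h'
    exact ⟨rfl, h''⟩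

/-- Different games are described by different words. -/
theorem RationalGame.encode_injective : Function.Injective RationalGame.encode := by
  have key : ∀ G : RationalGame,
      (G.encode.filter fun s => match s with | .owner _ => true | _ => false).length = G.n := by
    intro G
    have hb : ∀ k : ℕ, ((encodeBinary k).filter
        fun s => match s with | .owner _ => true | _ => false) = [] := by
      intro k
      refine List.filter_eq_nil_iff.2 fun a ha => ?_
      obtain ⟨b, -, rfl⟩ := List.mem_map.1 ha
      simp
    have hr : ∀ l : List ℚ, ((l.flatMap encodeRat).filter
        fun s => match s with | .owner _ => true | _ => false) = [] := by
      intro l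
      induction l with
      | nil => rfl
      | cons a l ih => simp [encodeRat, hb, ih]
    have hrows : ∀ l : List (Owner × List ℚ), ((l.flatMap encodeRow).filter
        fun s => match s with | .owner _ => true | _ => false).length = l.length := by
      intro l
      induction l with
      | nil => rfl
      | cons a l ih =>
        rw [List.flatMap_cons, List.filter_append, List.length_append, ih]
        simp [encodeRow, hr, Nat.add_comm]
    simp [RationalGame.encode, hrows]
  rintro G H h
  have hn : G.n = H.n := by rw [← key G, h, key H]
  obtain ⟨n, g, q, hq⟩ := G
  obtain ⟨m, g', q', hq'⟩ := H
  obtain rfl : n = m := hn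
  have hpos : ∀ v w, 0 ≤ q v w := fun v w => by
    have := g.δ_nonneg v w; rw [← hq] at this; exact_mod_cast this
  have hpos' : ∀ v w, 0 ≤ q' v w := fun v w => by
    have := g'.δ_nonneg v w; rw [← hq'] at this; exact_mod_cast this
  have hrow := flatMap_append_inj encodeRow
    (fun r => r.2.length = n ∧ ∀ x ∈ r.2, (0 : ℚ) ≤ x)
    (by
      rintro ⟨o, l⟩ ⟨o', l'⟩ ⟨h1, h2⟩ ⟨h3, h4⟩ u w huw
      simp only [encodeRow, List.cons_append, List.cons.injEq, GameSymbol.owner.injEq] at huw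
      obtain ⟨rfl, hc⟩ := flatMap_append_inj encodeRat (fun x => 0 ≤ x)
        (fun a b ha hb u w huw => encodeRat_append_inj ha hb huw) l l' h2 h4
        (h1.trans h3.symm) u w huw.2
      exact ⟨by rw [huw.1], hc⟩)
    (List.ofFn fun v => (g.owner v, List.ofFn (q v)))
    (List.ofFn fun v => (g'.owner v, List.ofFn (q' v)))
    (by
      intro r hr
      obtain ⟨v, rfl⟩ := (List.mem_ofFn' _ _).1 hr
      refine ⟨by simp, fun x hx => ?_⟩
      obtain ⟨w, rfl⟩ := (List.mem_ofFn' _ _).1 hx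
      exact hpos v w)
    (by
      intro r hr
      obtain ⟨v, rfl⟩ := (List.mem_ofFn' _ _).1 hr
      refine ⟨by simp, fun x hx => ?_⟩
      obtain ⟨w, rfl⟩ := (List.mem_ofFn' _ _).1 hx
      exact hpos' v w)
    (by simp) [] [] (by simpa [RationalGame.encode] using h)
  have h0 := List.ofFn_injective hrow.1
  have hq'' : q = q' := by
    funext v
    exact List.ofFn_injective (congrArg Prod.snd (congrFun h0 v))
  have ho : g.owner = g'.owner := by
    funext v
    exact congrArg Prod.fst (congrFun h0 v)
  have hδ : g.δ = g'.δ := by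
    funext v w
    rw [← hq, ← hq', hq'']
  obtain rfl : g = g' := by
    cases g; cases g'; cases ho; cases hδ; rfl
  subst hq''
  rfl

/-- A property of inputs, written as words over a finite alphabet, is decidable in polynomial time:
a Turing machine (multi-stack machine with finitely many stacks, labels, internal states and stack
symbols) computes its truth value within a number of steps that is bounded by a polynomial in the
length of the input word. -/
def DecidableInPolyTime {α Γ : Type} (encode : α → List Γ) (P : α → Prop) : Prop :=
  ∃ f : α → Bool, (∀ a, f a = true ↔ P a) ∧
    ∃ M : Turing.TM2ComputableInPolyTime encode Computability.encodeBool f,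
      ∀ k, Finite (M.tm.Γ k)

/-! Only the graph of positive transitions matters: a game is stopping under fairness exactly when
it has no nonempty trap (`stoppingUnderFairness_iff`). In a nonempty trap Player 1 can stay forever
while Player 2 moves uniformly at random, which is fair, so no terminal vertex is reached.
Conversely, consider a fair play that avoids terminal vertices, and the nonempty set of vertices it
visits infinitely often. This set contains all successors of its Player 2 vertices by fairness,
almost surely those of its chance vertices by Lévy's conditional Borel–Cantelli lemma
(`ae_infOften_of_mem_support`), and some successor of each of its vertices by pigeonhole. Hence it
is a trap.

The complement of the largest trap is a least fixed point: starting from nothing, mark a vertex as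
soon as it is `Absorbed` by the marked ones. Marked vertices lie in no trap (`Sound`), and once
nothing more can be marked the unmarked vertices form a trap, so the answer is whether all are
marked (`stoppingUnderFairness_iff_forall`).

The machine stores no vertex numbers. It keeps one mark per vertex on a stack and moves these marks
to a second stack in step with the fields of a row. Tags carry the parity of the sweep, so the first
entry with the old parity belongs to the vertex whose row is being read. Every sweep but the last
marks a new vertex; hence at most `n + 1` sweeps occur and the running time is cubic. -/

namespace StochasticGame

open MeasureTheory ProbabilityTheory Filter Finset

/-! ### Almost sure behaviour of plays -/

section Plays

variable {V : Type*} [Fintype V] {G : StochasticGame V}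

theorem nextDist_support (σ₁ : G.Strategy Owner.player1) (σ₂ : G.Strategy Owner.player2)
    (h : List V) (v : V) : (nextDist σ₁ σ₂ h v).support ⊆ G.post v := by
  unfold nextDist
  split
  · exact σ₁.act_support h _
  · exact σ₂.act_support h _
  · intro w hw
    simpa [chanceDist, post] using hw

variable [MeasurableSpace V] [DiscreteMeasurableSpace V]

instance (σ₁ : G.Strategy Owner.player1) (σ₂ : G.Strategy Owner.player2) (v : V) :
    IsProbabilityMeasure (prob σ₁ σ₂ v) := by
  unfold prob; infer_instance

theorem ae_traj_frestrictLe_eq (σ₁ : G.Strategy Owner.player1) (σ₂ : G.Strategy Owner.player2)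
    (n : ℕ) (x : Iic n → V) :
    ∀ᵐ ω ∂Kernel.traj (X := fun _ => V) (stepKernel σ₁ σ₂) n x,
      Preorder.frestrictLe (π := fun _ => V) n ω = x := by
  have h := Kernel.traj_map_frestrictLe_apply (X := fun _ => V) (κ := stepKernel σ₁ σ₂) n n x
  rw [Kernel.partialTraj_self, Kernel.id_apply] at h
  have h2 : ∀ᵐ y ∂(Measure.dirac x), y = x := by simp [ae_dirac_eq]
  rw [← h] at h2
  exact ae_of_ae_map (Preorder.measurable_frestrictLe n).aemeasurable h2

theorem ae_prob_zero (σ₁ : G.Strategy Owner.player1) (σ₂ : G.Strategy Owner.player2) (v : V) :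
    ∀ᵐ ω ∂prob σ₁ σ₂ v, ω 0 = v := by
  filter_upwards [ae_traj_frestrictLe_eq σ₁ σ₂ 0 (fun _ => v)] with ω h
  exact congrFun h ⟨0, by simp⟩

/-- Almost every play only takes transitions to which the current distribution gives weight. -/
theorem ae_mem_support (σ₁ : G.Strategy Owner.player1) (σ₂ : G.Strategy Owner.player2) (v : V) :
    ∀ᵐ ω ∂prob σ₁ σ₂ v, ∀ k, ω (k + 1) ∈
      (nextDist σ₁ σ₂ (List.ofFn fun i : Fin k => ω i) (ω k)).support := by
  rw [ae_all_iff]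
  intro k
  -- The joint law of the first `k + 1` vertices and the next one is a composition product, so the
  -- claim can be checked under `stepKernel` for each fixed history.
  have h := Kernel.partialTraj_compProd_eq_map_traj (X := fun _ => V) (κ := stepKernel σ₁ σ₂)
    (Nat.zero_le k) (x₀ := fun _ => v)
  have h2 : ∀ᵐ p ∂((Kernel.partialTraj (X := fun _ => V) (stepKernel σ₁ σ₂) 0 k fun _ => v) ⊗ₘ
      stepKernel σ₁ σ₂ k), p.2 ∈ (nextDist σ₁ σ₂
        (List.ofFn fun i : Fin k => p.1 ⟨i, Finset.mem_Iic.2 i.is_lt.le⟩)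
        (p.1 ⟨k, Finset.mem_Iic.2 le_rfl⟩)).support := by
    refine (Measure.ae_compProd_iff (Set.toFinite _).measurableSet).2 (ae_of_all _ fun x => ?_)
    rw [ae_iff]
    exact (PMF.toMeasure_apply_eq_zero_iff _ (Set.toFinite _).measurableSet).2
      (Set.disjoint_left.2 fun a ha hb => hb ha)
  rw [h] at h2
  exact ae_of_ae_map (by fun_prop) h2

theorem ae_mem_paths (σ₁ : G.Strategy Owner.player1) (σ₂ : G.Strategy Owner.player2) (v : V) :
    ∀ᵐ ω ∂prob σ₁ σ₂ v, ω ∈ G.paths := by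
  filter_upwards [ae_mem_support σ₁ σ₂ v] with ω h k
  exact nextDist_support σ₁ σ₂ _ _ (h k)

/-- If the distribution at a vertex does not depend on the history, then almost surely every
vertex in its support is visited infinitely often whenever the vertex itself is. -/
theorem ae_infOften_of_mem_support (σ₁ : G.Strategy Owner.player1)
    (σ₂ : G.Strategy Owner.player2) (v : V) {a b : V} {d : PMF V}
    (hd : ∀ h, nextDist σ₁ σ₂ h a = d) (hb : b ∈ d.support) :
    ∀ᵐ ω ∂prob σ₁ σ₂ v, a ∈ infOften ω → b ∈ infOften ω := by
  -- The index is shifted so that `s (k + 1)` is the transition from time `k` to time `k + 1`, and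
  -- `s n` depends on the coordinates up to `n` only.
  set s : ℕ → Set (ℕ → V) := fun k => {ω | ω (k - 1) = a ∧ ω k = b} with hs
  have hms : ∀ n, MeasurableSet[Filtration.piLE (X := fun _ : ℕ => V) n] (s n) := by
    intro n
    rw [Filtration.piLE_eq_comap_frestrictLe]
    exact ⟨{x | x ⟨n - 1, by simp⟩ = a ∧ x ⟨n, by simp⟩ = b}, (Set.toFinite _).measurableSet, rfl⟩
  have hms' : ∀ n, MeasurableSet (s n) := fun n => (Filtration.piLE (X := fun _ : ℕ => V)).le n _ (hms n)
  have hpos : 0 < (d b).toReal :=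
    ENNReal.toReal_pos ((PMF.mem_support_iff _ _).1 hb) (PMF.apply_ne_top _ _)
  have hce : ∀ᵐ ω ∂prob σ₁ σ₂ v, ∀ k, ({ω | ω k = a}.indicator (fun _ => (d b).toReal) ω) ≤
      ((prob σ₁ σ₂ v)[(s (k + 1)).indicator (1 : (ℕ → V) → ℝ) |
        Filtration.piLE (X := fun _ : ℕ => V) k]) ω := by
    rw [ae_all_iff]
    intro k
    have h1 := Kernel.condExp_traj (X := fun _ => V) (κ := stepKernel σ₁ σ₂) (Nat.zero_le k)
      (x₀ := fun _ => v) (f := (s (k + 1)).indicator (1 : (ℕ → V) → ℝ))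
      ((integrable_const (1 : ℝ)).indicator (hms' _))
    filter_upwards [h1] with ω h
    refine le_of_le_of_eq ?_ h.symm
    rw [integral_indicator_one (hms' _)]
    by_cases hω : ω k = a
    · have h2 : (Kernel.traj (X := fun _ => V) (stepKernel σ₁ σ₂) k
          (Preorder.frestrictLe k ω)) (s (k + 1)) = d b := by
        have h3 : s (k + 1) =ᵐ[Kernel.traj (X := fun _ => V) (stepKernel σ₁ σ₂) k
            (Preorder.frestrictLe k ω)] (fun x : ℕ → V => x (k + 1)) ⁻¹' {b} := by
          filter_upwards [ae_traj_frestrictLe_eq σ₁ σ₂ k (Preorder.frestrictLe k ω)] with y hy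
          have h4 : y k = a := (congrFun hy ⟨k, by simp⟩).trans hω
          refine eq_iff_iff.2 ⟨fun h => h.2, fun h => ⟨by simpa using h4, h⟩⟩
        rw [measure_congr h3, ← Measure.map_apply (by fun_prop) (measurableSet_singleton b),
          ← Kernel.map_apply _ (by fun_prop), Kernel.map_traj_succ_self]
        change (nextDist σ₁ σ₂ _ (ω k)).toMeasure {b} = _
        rw [PMF.toMeasure_apply_singleton _ _ (measurableSet_singleton b), hω, hd]
      rw [Set.indicator_of_mem (by exact hω), measureReal_def, h2]
    · rw [Set.indicator_of_notMem (by exact hω)]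
      exact measureReal_nonneg
  filter_upwards [hce, ae_mem_limsup_atTop_iff (prob σ₁ σ₂ v) hms] with ω h1 h2 ha
  have h3 : ω ∈ limsup (fun k => {ω : ℕ → V | ω k = a}) atTop := by
    rw [mem_limsup_iff_frequently_mem]; exact ha
  -- Each visit to `a` contributes the same positive weight, so infinitely many visits make the sum
  -- of conditional probabilities diverge.
  rw [Set.limsup_eq_tendsto_sum_indicator_atTop hpos] at h3
  have h4 := h2.2 (tendsto_atTop_mono (fun n => Finset.sum_le_sum fun k _ => h1 k) h3)
  rw [mem_limsup_iff_frequently_mem] at h4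
  exact h4.mono fun k hk => hk.2

end Plays

/-! ### Traps and the combinatorial criterion -/

section Traps

variable {V : Type*} [Fintype V] (G : StochasticGame V)

/-- A set of non-terminal vertices in which Player 1 can keep the play whatever happens at the
other vertices. -/
def IsTrap (U : Set V) : Prop :=
  ∀ v ∈ U, v ∉ G.terminal ∧ (G.owner v = Owner.player1 → ∃ w ∈ U, 0 < G.δ v w) ∧
    (G.owner v ≠ Owner.player1 → G.post v ⊆ U)

variable {G}

/-- A sole successor has probability one, by the 0/1 condition at player vertices and by total mass
at chance vertices. Hence terminality can be tested from the signs of the entries alone. -/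
theorem mem_terminal_iff (v : V) : v ∈ G.terminal ↔ ∀ w, 0 < G.δ v w → w = v := by
  constructor
  · rintro ⟨-, h⟩ w hw
    by_contra hne
    rw [h w hne] at hw
    exact lt_irrefl _ hw
  · intro h
    have h0 : ∀ w, w ≠ v → G.δ v w = 0 := fun w hw =>
      le_antisymm (not_lt.1 fun hlt => hw (h w hlt)) (G.δ_nonneg v w)
    refine ⟨?_, h0⟩
    by_cases ho : G.owner v = Owner.chance
    · rw [← G.δ_chance v ho, Finset.sum_eq_single v (fun w _ hw => h0 w hw) (by simp)]
    · obtain ⟨w, hw⟩ := G.exists_succ v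
      obtain rfl := h w hw
      exact (G.δ_player w ho w).resolve_left hw.ne'

theorem exists_mem_infOften (ω : ℕ → V) : (infOften ω).Nonempty := by
  obtain ⟨v, hv⟩ := Finite.exists_infinite_fiber ω
  exact ⟨v, Nat.frequently_atTop_iff_infinite.2 (Set.infinite_coe_iff.1 hv)⟩

/-- A vertex that is visited infinitely often by a path has a successor with that property. -/
theorem exists_succ_mem_infOften {ω : ℕ → V} (hω : ω ∈ G.paths) {v : V} (hv : v ∈ infOften ω) :
    ∃ w ∈ infOften ω, 0 < G.δ v w := by
  have h : ∃ᶠ k in atTop, ∃ w, ω k = v ∧ ω (k + 1) = w := hv.mono fun k hk => ⟨_, hk, rfl⟩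
  have h2 : ∃ w, ∃ᶠ k in atTop, ω k = v ∧ ω (k + 1) = w := by
    by_contra hc
    push Not at hc
    refine h ?_
    filter_upwards [eventually_all.2 fun w => hc w] with k hk
    rintro ⟨w, hw⟩
    exact hk w hw.1 hw.2
  obtain ⟨w, hw⟩ := h2
  obtain ⟨k, hk⟩ := hw.exists
  refine ⟨w, ?_, hk.1 ▸ hk.2 ▸ hω k⟩
  have h3 : ∃ᶠ k in atTop, ω (k + 1) = w := hw.mono fun k hk => hk.2
  rw [infOften, Set.mem_ofPred_eq, ← map_add_atTop_eq_nat 1, frequently_map]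
  exact h3

/-- Fairness and `hchance` give closure at Player 2 and chance vertices; at Player 1 vertices one
recurring successor is enough. -/
theorem isTrap_infOften {ω : ℕ → V} (hω : ω ∈ G.fairPlays)
    (hchance : ∀ v, G.owner v = Owner.chance → v ∈ infOften ω → G.post v ⊆ infOften ω)
    (hT : ∀ i, ω i ∉ G.terminal) : G.IsTrap (infOften ω) := by
  intro v hv
  refine ⟨?_, fun _ => exists_succ_mem_infOften hω.1 hv, fun ho => ?_⟩
  · obtain ⟨k, rfl⟩ := hv.exists
    exact hT k
  · cases h : G.owner v
    · exact absurd h ho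
    · exact hω.2 v h hv
    · exact hchance v h hv

open Classical in
/-- The strategy of Player 2 that chooses a successor uniformly at random. -/
noncomputable def uniformStrategy (G : StochasticGame V) (i : Owner) : G.Strategy i where
  act _ v := PMF.uniformOfFinset (G.post v).toFinset (by
    obtain ⟨w, hw⟩ := G.exists_succ v
    exact ⟨w, Set.mem_toFinset.2 hw⟩)
  act_support h v := by simp

open Classical in
/-- The strategy that stays in the set `U` as long as possible. -/
noncomputable def stayStrategy (G : StochasticGame V) (i : Owner) (U : Set V) : G.Strategy i where
  act h v := if hv : ∃ w ∈ U, 0 < G.δ v w then PMF.pure hv.choose else (uniformStrategy G i).act h v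
  act_support h v := by
    split_ifs with hv
    · rw [PMF.support_pure, Set.singleton_subset_iff]
      exact hv.choose_spec.2
    · exact (uniformStrategy G i).act_support h v

variable [MeasurableSpace V] [DiscreteMeasurableSpace V]

/-- Needed because fairness is stated as "measure one", which yields an almost-everywhere statement
through measurability of the set. -/
theorem measurableSet_fairPlays : MeasurableSet G.fairPlays := by
  have h1 : ∀ v, MeasurableSet {ω : ℕ → V | v ∈ infOften ω} := by
    intro v
    have : {ω : ℕ → V | v ∈ infOften ω} = limsup (fun k => {ω : ℕ → V | ω k = v}) atTop := by
      ext ω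
      rw [mem_limsup_iff_frequently_mem]
      rfl
    rw [this]
    exact MeasurableSet.measurableSet_limsup fun k =>
      (measurable_pi_apply k : Measurable fun ω : ℕ → V => ω k) (measurableSet_singleton v)
  have h2 : G.fairPlays = (⋂ k, {ω : ℕ → V | 0 < G.δ (ω k) (ω (k + 1))}) ∩
      ⋂ v, ⋂ w, {ω : ℕ → V | (G.owner v = Owner.player2 ∧ w ∈ G.post v) →
        v ∈ infOften ω → w ∈ infOften ω} := by
    ext ω
    simp only [fairPlays, paths, Set.subset_def, Set.mem_ofPred_eq, Set.mem_inter_iff,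
      Set.mem_iInter]
    exact and_congr_right fun _ =>
      ⟨fun h v w hw hv => h v hw.1 hv w hw.2, fun h v ho hv w hw => h v w ⟨ho, hw⟩ hv⟩
  rw [h2]
  refine (MeasurableSet.iInter fun k => ?_).inter
    (MeasurableSet.iInter fun v => MeasurableSet.iInter fun w => ?_)
  · exact (show Measurable fun ω : ℕ → V => (ω k, ω (k + 1)) by fun_prop)
      (Set.toFinite {p : V × V | 0 < G.δ p.1 p.2}).measurableSet
  · exact (MeasurableSet.const _).imp ((h1 v).imp (h1 w))

theorem prob_eq_one_of_ae {σ₁ : G.Strategy Owner.player1} {σ₂ : G.Strategy Owner.player2} {v : V}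
    {S : Set (ℕ → V)} (h : ∀ᵐ ω ∂prob σ₁ σ₂ v, ω ∈ S) : prob σ₁ σ₂ v S = 1 := by
  rw [measure_congr (eventuallyEq_univ.2 h : S =ᵐ[_] Set.univ), measure_univ]

/-- The uniform choice ignores the history and gives every successor positive weight, so
`ae_infOften_of_mem_support` applies against any opponent. -/
theorem isFair_uniformStrategy : IsFair (G.uniformStrategy Owner.player2) := by
  intro σ₁ v
  apply prob_eq_one_of_ae
  have h : ∀ᵐ ω ∂prob σ₁ (G.uniformStrategy Owner.player2) v, ∀ a b,
      (G.owner a = Owner.player2 ∧ b ∈ G.post a) → a ∈ infOften ω → b ∈ infOften ω := by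
    simp only [ae_all_iff]
    rintro a b ⟨ha, hb⟩
    refine ae_infOften_of_mem_support σ₁ _ v (a := a)
      (d := (G.uniformStrategy Owner.player2).act [] ⟨a, ha⟩) (fun h => ?_) ?_
    · unfold nextDist
      split
      · next hv => exact absurd (ha.symm.trans hv) (by decide)
      · rfl
      · next hv => exact absurd (ha.symm.trans hv) (by decide)
    · simpa [uniformStrategy] using hb
  filter_upwards [ae_mem_paths σ₁ (G.uniformStrategy Owner.player2) v, h] with ω h1 h2
  exact ⟨h1, fun a ha hi b hb => h2 a b ⟨ha, hb⟩ hi⟩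

theorem ae_chance_infOften (σ₁ : G.Strategy Owner.player1) (σ₂ : G.Strategy Owner.player2) (v : V) :
    ∀ᵐ ω ∂prob σ₁ σ₂ v, ∀ a, G.owner a = Owner.chance → a ∈ infOften ω →
      G.post a ⊆ infOften ω := by
  have h : ∀ᵐ ω ∂prob σ₁ σ₂ v, ∀ a b,
      (G.owner a = Owner.chance ∧ b ∈ G.post a) → a ∈ infOften ω → b ∈ infOften ω := by
    simp only [ae_all_iff]
    rintro a b ⟨ha, hb⟩
    refine ae_infOften_of_mem_support σ₁ _ v (a := a) (d := G.chanceDist a ha) (fun h => ?_) ?_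
    · unfold nextDist
      split
      · next hv => exact absurd (ha.symm.trans hv) (by decide)
      · next hv => exact absurd (ha.symm.trans hv) (by decide)
      · rfl
    · simpa [chanceDist, post] using hb
  filter_upwards [h] with ω h a ha hi b hb using h a b ⟨ha, hb⟩ hi

/-- A game is stopping under fairness if and only if it has no nonempty trap. -/
theorem stoppingUnderFairness_iff :
    G.StoppingUnderFairness ↔ ∀ U, G.IsTrap U → U = ∅ := by
  constructor
  · intro hS U hU
    by_contra hne
    obtain ⟨v, hv⟩ := Set.nonempty_iff_ne_empty.2 hne
    have h1 := hS (G.stayStrategy Owner.player1 U) _ isFair_uniformStrategy v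
    have h2 : ∀ᵐ ω ∂prob (G.stayStrategy Owner.player1 U) (G.uniformStrategy Owner.player2) v,
        ω ∉ G.reachTerminal := by
      filter_upwards [ae_mem_support (G.stayStrategy Owner.player1 U)
        (G.uniformStrategy Owner.player2) v, ae_prob_zero (G.stayStrategy Owner.player1 U)
        (G.uniformStrategy Owner.player2) v] with ω hω h0
      rintro ⟨-, i, hi⟩
      have h3 : ∀ k, ω k ∈ U := by
        intro k
        induction k with
        | zero => rwa [h0]
        | succ k ih =>
          have h4 := hω k
          by_cases ho : G.owner (ω k) = Owner.player1
          · unfold nextDist at h4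
            split at h4
            · have h5 := (hU _ ih).2.1 ho
              simp only [stayStrategy, dif_pos h5, PMF.support_pure, Set.mem_singleton_iff] at h4
              rw [h4]
              exact h5.choose_spec.1
            · next hv => exact absurd (ho.symm.trans hv) (by decide)
            · next hv => exact absurd (ho.symm.trans hv) (by decide)
          · exact (hU _ ih).2.2 ho (nextDist_support _ _ _ _ h4)
      exact (hU _ (h3 i)).1 hi
    rw [measure_eq_zero_iff_ae_notMem.2 h2] at h1
    exact zero_ne_one h1
  · intro h σ₁ σ₂ hσ v
    apply prob_eq_one_of_ae
    have h1 := (mem_ae_iff_prob_eq_one measurableSet_fairPlays).2 (hσ σ₁ v)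
    filter_upwards [h1, ae_chance_infOften σ₁ σ₂ v] with ω hω hc
    refine ⟨hω.1, ?_⟩
    by_contra hT
    push Not at hT
    exact (exists_mem_infOften ω).ne_empty (h _ (isTrap_infOften hω hc hT))

end Traps

end StochasticGame

/-! ### The stack machine -/

namespace AttractorMachine

open Turing

instance : Fintype Owner :=
  ⟨{Owner.player1, Owner.player2, Owner.chance}, fun x => by cases x <;> simp⟩

instance : Fintype GameSymbol :=
  Fintype.ofSurjective
    (Sum.elim GameSymbol.owner (Sum.elim GameSymbol.bit fun b : Bool =>
      cond b GameSymbol.slash GameSymbol.comma)) (by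
    rintro (o | b | _ | _)
    · exact ⟨Sum.inl o, rfl⟩
    · exact ⟨Sum.inr (Sum.inl b), rfl⟩
    · exact ⟨Sum.inr (Sum.inr true), rfl⟩
    · exact ⟨Sum.inr (Sum.inr false), rfl⟩)

/-- The stacks: the unread and the read part of the input, the list of marks of the vertices, the
part of this list that has been traversed, and the output. -/
inductive Stack where
  | inp | buf | marks | aux | out
  deriving DecidableEq

instance : Fintype Stack :=
  ⟨{.inp, .buf, .marks, .aux, .out}, fun x => by cases x <;> simp⟩

/-- A mark is paired with a tag that tells whether the row of the vertex has been processed in the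
current sweep; on the auxiliary stack there is also a flag at the vertex of the current row. -/
abbrev Alphabet : Stack → Type
  | .inp => GameSymbol
  | .buf => GameSymbol
  | .marks => Bool × Bool
  | .aux => Bool × Bool × Bool
  | .out => Bool

instance fintypeAlphabet : ∀ k, Fintype (Alphabet k)
  | .inp => inferInstanceAs (Fintype GameSymbol)
  | .buf => inferInstanceAs (Fintype GameSymbol)
  | .marks => inferInstanceAs (Fintype (Bool × Bool))
  | .aux => inferInstanceAs (Fintype (Bool × Bool × Bool))
  | .out => inferInstanceAs (Fintype Bool)

inductive Label where
  | count | rewind | scan | back | clear | clearInput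
  deriving DecidableEq

instance : Fintype Label :=
  ⟨{.count, .rewind, .scan, .back, .clear, .clearInput}, fun x => by cases x <;> simp⟩

/-- The internal state. While a row is scanned, `seen` tells whether the column of its own vertex
has been passed, `any` and `all` whether some and all successors so far are marked, and `nonself`
whether there was a successor other than the vertex itself. -/
@[ext]
structure Reg where
  p1 : Bool := false
  seen : Bool := false
  any : Bool := false
  all : Bool := true
  nonself : Bool := false
  bit : Bool := false
  nz : Bool := false
  par : Bool := false
  chg : Bool := false
  ans : Bool := true
  last : Bool := false
  sym : Option GameSymbol := none
  entry : Option (Bool × Bool × Bool) := none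

noncomputable instance : Fintype Reg :=
  Fintype.ofInjective
    (fun v : Reg =>
      ((v.p1, v.seen, v.any, v.all, v.nonself), (v.bit, v.nz, v.par, v.chg, v.ans, v.last),
        v.sym, v.entry))
    (fun v w h => by
      simp only [Prod.mk.injEq] at h
      ext1 <;> simp only [h])

/-- Read a symbol other than a comma. -/
def Reg.read (v : Reg) : Reg :=
  match v.sym with
  | some (.owner o) => { v with p1 := decide (o = Owner.player1), sym := none }
  | some (.bit _) => { v with bit := true, sym := none }
  | some .slash => { v with nz := v.bit, sym := none }
  | _ => v

/-- Process a field of a row, given the mark and the tag of its column. -/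
def Reg.field (v : Reg) : Option (Bool × Bool) → Reg
  | none => v
  | some (m, t) =>
    { v with
      -- `!v.seen && (t != v.par)` recognises the column of the row's own vertex: the first one
      -- whose tag is not yet of the current parity.
      seen := v.seen || (!v.seen && (t != v.par))
      any := v.any || (v.nz && m)
      all := v.all && (!v.nz || m)
      nonself := v.nonself || (v.nz && !(!v.seen && (t != v.par)))
      bit := false
      nz := false
      sym := none
      entry := some (m, t, !v.seen && (t != v.par)) }

/-- Whether the vertex of the row that has been scanned is to be marked. -/
def Reg.new (v : Reg) : Bool := !v.nonself || cond v.p1 v.all v.any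

/-- Only the flagged entry, that of the row's own vertex, changes; its tag then records that its row
is done. Marks are never removed. -/
def Reg.update (v : Reg) (e : Bool × Bool × Bool) : Bool × Bool :=
  if e.2.2 then (e.1 || v.new, v.par) else (e.1, e.2.1)

/-- Mark, sweep after sweep over the rows, the vertices from which a terminal vertex can be
enforced, until nothing changes. -/
def program : Label → TM2.Stmt Alphabet Label Reg
  | .count =>
    .pop .inp (fun v s => { v with sym := s }) <|
    .branch (fun v => v.sym.isNone)
      -- Pretending that something has changed forces the first sweep.
      (.load (fun v => { v with chg := true }) <| .goto fun _ => .rewind) <|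
    .push .buf (fun v => v.sym.getD .slash) <|
    .branch (fun v => match v.sym with | some (.owner _) => true | _ => false)
      (.push .marks (fun _ => (false, false)) <|
        .load (fun v => { v with sym := none }) <| .goto fun _ => .count)
      (.load (fun v => { v with sym := none }) <| .goto fun _ => .count)
  | .rewind =>
    .pop .buf (fun v s => { v with sym := s }) <|
    .branch (fun v => v.sym.isNone)
      (.branch (fun v => v.chg)
        -- Flipping the parity makes all tags stale at once, so they need no resetting.
        (.load (fun v => { v with par := !v.par, chg := false }) <| .goto fun _ => .scan)
        (.goto fun _ => .clear)) <|
    .push .inp (fun v => v.sym.getD .slash) <|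
    .load (fun v => { v with sym := none }) <| .goto fun _ => .rewind
  | .scan =>
    .pop .inp (fun v s => { v with sym := s }) <|
    .branch (fun v => v.sym.isNone) (.goto fun _ => .rewind) <|
    .push .buf (fun v => v.sym.getD .slash) <|
    .branch (fun v => v.sym = some .comma)
      (.pop .marks Reg.field <|
        .push .aux (fun v => v.entry.getD (false, false, false)) <|
        .peek .marks (fun v m => { v with entry := none, last := m.isNone }) <|
        -- A row has as many fields as there are marks, so an exhausted `marks` stack signals the
        -- end of the row.
        .goto fun v => if v.last then .back else .scan)
      (.load Reg.read <| .goto fun _ => .scan)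
  | .back =>
    .pop .aux (fun v e => { v with entry := e }) <|
    .branch (fun v => v.entry.isNone)
      (.load (fun v => { par := v.par, chg := v.chg }) <| .goto fun _ => .scan) <|
    .push .marks (fun v => v.update (v.entry.getD (false, false, false))) <|
    .load (fun v => { v with
      chg := v.chg || ((v.entry.getD (false, false, false)).2.2 && v.new &&
        !(v.entry.getD (false, false, false)).1)
      entry := none }) <|
    .goto fun _ => .back
  | .clear =>
    -- The default `true` is neutral for the conjunction, so the final pop from the empty stack does
    -- not affect the answer.
    .pop .marks (fun v m => { v with
      last := m.isNone, ans := v.ans && (m.getD (true, true)).1 }) <|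
    .goto fun v => if v.last then .clearInput else .clear
  | .clearInput =>
    .pop .inp (fun v s => { v with sym := s }) <|
    .branch (fun v => v.sym.isNone)
      -- A halting configuration must have the initial register and all stacks empty except the
      -- output.
      (.push .out (fun v => v.ans) <| .load (fun _ => {}) .halt)
      (.goto fun _ => .clearInput)

/-! ### Configurations and runs of bounded length -/

def tapes (a b : List GameSymbol) (x : List (Bool × Bool)) (y : List (Bool × Bool × Bool))
    (o : List Bool) : ∀ k, List (Alphabet k)
  | .inp => a
  | .buf => b
  | .marks => x
  | .aux => y
  | .out => o

section

variable (a b : List GameSymbol) (x : List (Bool × Bool)) (y : List (Bool × Bool × Bool))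
  (o : List Bool)

@[simp] theorem tapes_inp : tapes a b x y o .inp = a := rfl
@[simp] theorem tapes_buf : tapes a b x y o .buf = b := rfl
@[simp] theorem tapes_marks : tapes a b x y o .marks = x := rfl
@[simp] theorem tapes_aux : tapes a b x y o .aux = y := rfl
@[simp] theorem tapes_out : tapes a b x y o .out = o := rfl

@[simp] theorem update_inp (l) :
    Function.update (tapes a b x y o) .inp l = tapes l b x y o := by
  funext k; cases k <;> rfl
@[simp] theorem update_buf (l) :
    Function.update (tapes a b x y o) .buf l = tapes a l x y o := by
  funext k; cases k <;> rfl
@[simp] theorem update_marks (l) :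
    Function.update (tapes a b x y o) .marks l = tapes a b l y o := by
  funext k; cases k <;> rfl
@[simp] theorem update_aux (l) :
    Function.update (tapes a b x y o) .aux l = tapes a b x l o := by
  funext k; cases k <;> rfl
@[simp] theorem update_out (l) :
    Function.update (tapes a b x y o) .out l = tapes a b x y l := by
  funext k; cases k <;> rfl

end

abbrev cfg (l : Label) (v : Reg) (a b : List GameSymbol) (x : List (Bool × Bool))
    (y : List (Bool × Bool × Bool)) : TM2.Cfg Alphabet Label Reg :=
  ⟨some l, v, tapes a b x y []⟩

/-- The machine reaches `c'` from `c` in at most `t` steps. -/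
def ReachesIn (t : ℕ) (c c' : TM2.Cfg Alphabet Label Reg) : Prop :=
  ∃ m ≤ t, (flip bind (TM2.step program))^[m] (some c) = some c'

variable {t t' : ℕ} {c c' c'' : TM2.Cfg Alphabet Label Reg}

theorem ReachesIn.refl (c) : ReachesIn 0 c c := ⟨0, le_rfl, rfl⟩

theorem ReachesIn.mono (h : ReachesIn t c c') (ht : t ≤ t') : ReachesIn t' c c' := by
  obtain ⟨m, hm, h⟩ := h
  exact ⟨m, hm.trans ht, h⟩

theorem ReachesIn.trans (h : ReachesIn t c c') (h' : ReachesIn t' c' c'') :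
    ReachesIn (t + t') c c'' := by
  obtain ⟨m, hm, h⟩ := h
  obtain ⟨m', hm', h'⟩ := h'
  refine ⟨m' + m, by omega, ?_⟩
  rw [Function.iterate_add_apply, h, h']

theorem ReachesIn.of_step (h : TM2.step program c = some c') : ReachesIn 1 c c' :=
  ⟨1, le_rfl, h⟩

theorem ReachesIn.head (h : TM2.step program c = some c') (h' : ReachesIn t c' c'') :
    ReachesIn (t + 1) c c'' :=
  ((ReachesIn.of_step h).trans h').mono (by omega)

/-! ### The phases of the program on arbitrary stack contents -/

def isOwner : GameSymbol → Bool
  | .owner _ => true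
  | _ => false

theorem reachesIn_count (w : List GameSymbol) (b x) :
    ReachesIn (w.length + 1) (cfg .count {} w b x [])
      (cfg .rewind { chg := true } [] (w.reverse ++ b)
        (List.replicate (w.countP isOwner) (false, false) ++ x) []) := by
  induction w generalizing b x with
  | nil => exact .of_step (by simp [program])
  | cons s w ih =>
    rcases s with o | d | _ | _
    · refine .head (c' := cfg .count {} w (.owner o :: b) ((false, false) :: x) [])
        (by simp [program]) ?_
      simpa [List.countP_cons, isOwner, List.replicate_succ'] using ih (.owner o :: b) ((false, false) :: x)
    · refine .head (c' := cfg .count {} w (.bit d :: b) x []) (by simp [program]) ?_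
      simpa [isOwner] using ih (.bit d :: b) x
    · refine .head (c' := cfg .count {} w (.slash :: b) x []) (by simp [program]) ?_
      simpa [isOwner] using ih (.slash :: b) x
    · refine .head (c' := cfg .count {} w (.comma :: b) x []) (by simp [program]) ?_
      simpa [isOwner] using ih (.comma :: b) x

/-- The run stops just before the step that finds `buf` empty, since that step depends on `chg`. -/
theorem reachesIn_rewind (v : Reg) (hv : v.sym = none) (a b x) :
    ReachesIn b.length (cfg .rewind v a b x []) (cfg .rewind v (b.reverse ++ a) [] x []) := by
  induction b generalizing a with
  | nil => exact .refl _
  | cons s b ih =>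
    refine .head (c' := cfg .rewind v (s :: a) b x []) ?_ (by simpa using ih (s :: a))
    simp [program, ← hv]

theorem reachesIn_bits (v : Reg) (hv : v.sym = none) (l : List Bool) (a b x y) :
    ReachesIn l.length (cfg .scan v (l.map .bit ++ a) b x y)
      (cfg .scan { v with bit := v.bit || !l.isEmpty } a ((l.map GameSymbol.bit).reverse ++ b)
        x y) := by
  induction l generalizing b v with
  | nil => simpa using ReachesIn.refl _
  | cons s l ih =>
    refine .head (c' := cfg .scan { v with bit := true } (l.map .bit ++ a) (.bit s :: b) x y) ?_
      (by simpa using ih { v with bit := true } hv (.bit s :: b))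
    simp [program, Reg.read, hv]

/-- Zero is the empty word, so an entry is positive iff a bit occurs before its slash. -/
theorem encodeNat_isEmpty (k : ℕ) : (Computability.encodeNat k).isEmpty = decide (k = 0) := by
  by_cases h : k = 0
  · subst h; rfl
  · rw [decide_eq_false h, List.isEmpty_eq_false_iff]
    intro hk
    have := Computability.decode_encodeNat k
    rw [hk] at this
    exact h this.symm

/-- The effect on the internal state of a field `r` whose column has mark `m` and tag `t`. -/
def Reg.afterField (v : Reg) (r : ℚ) (m t last : Bool) : Reg :=
  { { v with nz := decide (0 < r) }.field (some (m, t)) with entry := none, last := last }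

theorem reachesIn_field (v : Reg) (hs : v.sym = none) (hb : v.bit = false) (r : ℚ)
    (m t : Bool) (a b x y) :
    ReachesIn (encodeRat r).length (cfg .scan v (encodeRat r ++ a) b ((m, t) :: x) y)
      (cfg (if x.isEmpty then .back else .scan) (v.afterField r m t x.isEmpty) a
        ((encodeRat r).reverse ++ b) x ((m, t, !v.seen && (t != v.par)) :: y)) := by
  have hz : (!(Computability.encodeNat r.num.toNat).isEmpty) = decide (0 < r) := by
    rw [encodeNat_isEmpty, ← decide_not]
    have : 0 < r ↔ 0 < r.num := Rat.num_pos.symm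
    exact decide_eq_decide.2 (by rw [this]; omega)
  have h1 := reachesIn_bits v hs (Computability.encodeNat r.num.toNat)
    (.slash :: (encodeBinary r.den ++ .comma :: a)) b ((m, t) :: x) y
  rw [hz, hb] at h1
  set b1 := ((Computability.encodeNat r.num.toNat).map GameSymbol.bit).reverse ++ b
  have h2 := reachesIn_bits { v with bit := decide (0 < r), nz := decide (0 < r) } hs
    (Computability.encodeNat r.den) (.comma :: a) (.slash :: b1) ((m, t) :: x) y
  have h3 := h1.trans (.head (by simp [program, Reg.read, hs, encodeBinary]) h2)
  have h4 := h3.trans (.of_step (c' := (cfg (if x.isEmpty then .back else .scan)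
    (v.afterField r m t x.isEmpty) a
    (.comma :: (((Computability.encodeNat r.den).map GameSymbol.bit).reverse ++ .slash :: b1)) x
    ((m, t, !v.seen && (t != v.par)) :: y))) (by
      cases x <;> simp [program, Reg.field, Reg.afterField]))
  convert h4.mono (t' := (encodeRat r).length) (by simp [encodeRat, encodeBinary]) using 2
  · simp [encodeRat, encodeBinary]
  · simp [encodeRat, encodeBinary, b1]

/-- The updates use only `new` and `par`, which stay constant while the auxiliary stack is emptied.
-/
theorem reachesIn_back (v : Reg) (he : v.entry = none) (y a b x) :
    ReachesIn (y.length + 1) (cfg .back v a b x y)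
      (cfg .scan
        { par := v.par, chg := v.chg || (y.any fun e => e.2.2 && v.new && !e.1) } a b
        ((y.map v.update).reverse ++ x) []) := by
  induction y generalizing x v with
  | nil => exact .of_step (by simp [program])
  | cons e y ih =>
    refine .head (c' := cfg .back { v with chg := v.chg || (e.2.2 && v.new && !e.1) } a b
      (v.update e :: x) y) ?_ ?_
    · simp [program, Reg.update, Reg.new, he]
    · convert ih { v with chg := v.chg || (e.2.2 && v.new && !e.1) } he (v.update e :: x) using 2
      · rfl
      · change _ = ({ par := v.par, chg := (v.chg || (e.2.2 && v.new && !e.1)) ||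
          (y.any fun e => e.2.2 && v.new && !e.1) } : Reg)
        simp [Bool.or_assoc]
      · change _ = (y.map v.update).reverse ++ v.update e :: x
        simp

/-! ### Processing one row of a game -/

variable (G : RationalGame)

/-- The condition under which the vertex `k` is marked, given the set `W` of marked vertices. -/
def Absorbed (W : Fin G.n → Bool) (k : Fin G.n) : Prop :=
  (∀ i, 0 < G.q k i → i = k) ∨
    if G.game.owner k = Owner.player1 then ∀ i, 0 < G.q k i → W i = true
    else ∃ i, 0 < G.q k i ∧ W i = true

instance (W : Fin G.n → Bool) (k : Fin G.n) : Decidable (Absorbed G W k) := by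
  unfold Absorbed; infer_instance

/-- The marks before the row `k` is processed. -/
def markList (W : Fin G.n → Bool) (p : Bool) (k : ℕ) : List (Bool × Bool) :=
  List.ofFn fun i => (W i, if i.1 < k then p else !p)

/-- The marks after the row `k` has been scanned. -/
def auxList (W : Fin G.n → Bool) (p : Bool) (k : ℕ) : List (Bool × Bool × Bool) :=
  List.ofFn fun i => (W i, if i.1 < k then p else !p, decide (i.1 = k))

/-- The internal state after `j` fields of the row `k`. -/
def rowReg (W : Fin G.n → Bool) (p c : Bool) (k : Fin G.n) (j : ℕ) (last : Bool) : Reg where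
  p1 := decide (G.game.owner k = Owner.player1)
  seen := decide (k.1 < j)
  any := decide (∃ i : Fin G.n, i.1 < j ∧ 0 < G.q k i ∧ W i = true)
  all := decide (∀ i : Fin G.n, i.1 < j → 0 < G.q k i → W i = true)
  nonself := decide (∃ i : Fin G.n, i.1 < j ∧ 0 < G.q k i ∧ i ≠ k)
  par := p
  chg := c
  last := last

/-- Before row `k`, exactly the entries below `k` carry the current parity, so the first stale one
sits at column `k`. -/
theorem tag_self (p : Bool) (j k : ℕ) :
    (!decide (k < j) && ((if j < k then p else !p) != p)) = decide (j = k) := by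
  by_cases h1 : j < k
  · simp [h1, h1.ne]
  · by_cases h2 : k < j
    · simp [h2, h2.ne']
    · obtain rfl : j = k := by omega
      cases p <;> simp

theorem exists_lt_succ {n j : ℕ} (hj : j < n) (P : Fin n → Prop) :
    (∃ i : Fin n, i.1 < j + 1 ∧ P i) ↔ (∃ i : Fin n, i.1 < j ∧ P i) ∨ P ⟨j, hj⟩ := by
  constructor
  · rintro ⟨i, hi, h⟩
    rcases Nat.lt_succ_iff_lt_or_eq.1 hi with h' | rfl
    · exact Or.inl ⟨i, h', h⟩
    · exact Or.inr h
  · rintro (⟨i, hi, h⟩ | h)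
    · exact ⟨i, by omega, h⟩
    · exact ⟨⟨j, hj⟩, by simp, h⟩

theorem forall_lt_succ {n j : ℕ} (hj : j < n) (P : Fin n → Prop) :
    (∀ i : Fin n, i.1 < j + 1 → P i) ↔ (∀ i : Fin n, i.1 < j → P i) ∧ P ⟨j, hj⟩ := by
  have := exists_lt_succ hj fun i => ¬ P i
  rw [← not_iff_not]
  simpa [not_and_or, -not_and] using this

theorem rowReg_afterField (W : Fin G.n → Bool) (p c : Bool) (k : Fin G.n) {j : ℕ} (hj : j < G.n)
    (l l' : Bool) :
    (rowReg G W p c k j l).afterField (G.q k ⟨j, hj⟩) (W ⟨j, hj⟩) (if j < k.1 then p else !p) l' =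
      rowReg G W p c k (j + 1) l' := by
  have hs := tag_self p j k.1
  ext1
  case seen =>
    simp only [Reg.afterField, Reg.field, rowReg, hs, ← Bool.decide_or]
    exact decide_eq_decide.2 (by omega)
  case any =>
    simp only [Reg.afterField, Reg.field, rowReg, exists_lt_succ hj, Bool.decide_or,
      Bool.decide_and, Bool.decide_eq_true]
  case all =>
    simp only [Reg.afterField, Reg.field, rowReg]
    simp only [forall_lt_succ hj fun i => 0 < G.q k i → W i = true,
      imp_iff_not_or (a := 0 < G.q k ⟨j, hj⟩), Bool.decide_or,
      Bool.decide_and, Bool.decide_eq_true, decide_not]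
  case nonself =>
    simp only [Reg.afterField, Reg.field, rowReg, hs, exists_lt_succ hj, Bool.decide_or,
      Bool.decide_and, ne_eq, decide_not, Fin.ext_iff]
  all_goals rfl

theorem rowReg_new (W : Fin G.n → Bool) (p c : Bool) (k : Fin G.n) (l : Bool) :
    (rowReg G W p c k G.n l).new = decide (Absorbed G W k) := by
  have h1 : (!decide (∃ i, 0 < G.q k i ∧ ¬i = k)) = decide (∀ i, 0 < G.q k i → i = k) := by
    rw [← decide_not]
    exact decide_eq_decide.2 (by push Not; rfl)
  by_cases h : G.game.owner k = Owner.player1 <;>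
    simp [Reg.new, rowReg, Absorbed, h, h1]

theorem reachesIn_fields_step (W : Fin G.n → Bool) (p c : Bool) (k : Fin G.n) {j : ℕ}
    (hj : j < G.n) (a b) (l : Bool) :
    ReachesIn (encodeRat (G.q k ⟨j, hj⟩)).length
      (cfg .scan (rowReg G W p c k j l) (encodeRat (G.q k ⟨j, hj⟩) ++ a) b
        ((markList G W p k).drop j) ((auxList G W p k).take j).reverse)
      (cfg (if j + 1 = G.n then .back else .scan)
        (rowReg G W p c k (j + 1) (decide (j + 1 = G.n))) a
        ((encodeRat (G.q k ⟨j, hj⟩)).reverse ++ b) ((markList G W p k).drop (j + 1))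
        ((auxList G W p k).take (j + 1)).reverse) := by
  have h2 : (markList G W p k).drop j =
      (W ⟨j, hj⟩, if j < k.1 then p else !p) :: (markList G W p k).drop (j + 1) := by
    rw [List.drop_eq_getElem_cons (by simpa [markList] using hj)]
    simp only [markList, List.getElem_ofFn]
  have h3 : ((auxList G W p k).take (j + 1)).reverse =
      (W ⟨j, hj⟩, (if j < k.1 then p else !p), decide (j = k.1)) ::
        ((auxList G W p k).take j).reverse := by
    rw [List.take_succ_eq_append_getElem (by simpa [auxList] using hj), List.reverse_append]
    simp only [auxList, List.getElem_ofFn, List.reverse_singleton, List.singleton_append]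
  have h4 : ((markList G W p k).drop (j + 1)).isEmpty = decide (j + 1 = G.n) := by
    rw [Bool.eq_iff_iff, List.isEmpty_iff, List.drop_eq_nil_iff, decide_eq_true_iff, markList,
      List.length_ofFn]
    omega
  have hf := reachesIn_field (rowReg G W p c k j l) rfl rfl (G.q k ⟨j, hj⟩) (W ⟨j, hj⟩)
    (if j < k.1 then p else !p) a b
    ((markList G W p k).drop (j + 1)) ((auxList G W p k).take j).reverse
  rw [rowReg_afterField, show (!(rowReg G W p c k j l).seen &&
    ((if j < k.1 then p else !p) != (rowReg G W p c k j l).par)) = decide (j = k.1) from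
      tag_self p j k.1, ← h3, ← h2, h4] at hf
  simpa using hf

theorem drop_ofFn {α : Type*} {n : ℕ} (f : Fin n → α) {j : ℕ} (hj : j < n) :
    (List.ofFn f).drop j = f ⟨j, hj⟩ :: (List.ofFn f).drop (j + 1) := by
  rw [List.drop_eq_getElem_cons (by simpa using hj), List.getElem_ofFn]

theorem reachesIn_fields (W : Fin G.n → Bool) (p c : Bool) (k : Fin G.n) (d j : ℕ)
    -- At least one field must remain, because the end of the row is detected only on reading a
    -- comma.
    (hj : j + d + 1 = G.n) (a b) (l : Bool) :
    ReachesIn (((List.ofFn (G.q k)).drop j).flatMap encodeRat).length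
      (cfg .scan (rowReg G W p c k j l) (((List.ofFn (G.q k)).drop j).flatMap encodeRat ++ a) b
        ((markList G W p k).drop j) ((auxList G W p k).take j).reverse)
      (cfg .back (rowReg G W p c k G.n true) a
        ((((List.ofFn (G.q k)).drop j).flatMap encodeRat).reverse ++ b) []
        (auxList G W p k).reverse) := by
  induction d generalizing j b l with
  | zero =>
    rw [drop_ofFn (G.q k) (show j < G.n by omega)]
    have hf := reachesIn_fields_step G W p c k (show j < G.n by omega) a b l
    have h1 : (auxList G W p k).take (j + 1) = auxList G W p k :=
      List.take_of_length_le (by simp [auxList, show j + 1 = G.n by omega])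
    have h2 : (markList G W p k).drop (j + 1) = [] :=
      List.drop_eq_nil_of_le (by simp [markList, show j + 1 = G.n by omega])
    have h3 : (List.ofFn (G.q k)).drop (j + 1) = [] :=
      List.drop_eq_nil_of_le (by simp [show j + 1 = G.n by omega])
    rw [h1, h2, if_pos (by omega), decide_eq_true (by omega), show j + 1 = G.n by omega] at hf
    rw [h3]
    simpa using hf
  | succ d ih =>
    rw [drop_ofFn (G.q k) (show j < G.n by omega), List.flatMap_cons, List.append_assoc,
      List.length_append]
    have hf := reachesIn_fields_step G W p c k (show j < G.n by omega)
      (((List.ofFn (G.q k)).drop (j + 1)).flatMap encodeRat ++ a) b l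
    rw [if_neg (by omega)] at hf
    simpa using hf.trans (ih (j + 1) (by omega) _ _)

/-- The marks after the vertex `k` has been processed. -/
def mark (W : Fin G.n → Bool) (k : Fin G.n) : Fin G.n → Bool :=
  fun i => W i || (decide (i = k) && decide (Absorbed G W k))

/-- The rows from `k` on, as a word. -/
def rowsFrom (k : ℕ) : List GameSymbol :=
  ((List.ofFn fun v => (G.game.owner v, List.ofFn (G.q v))).drop k).flatMap encodeRow

theorem reachesIn_row (W : Fin G.n → Bool) (p c : Bool) (k : Fin G.n) (a b) :
    ReachesIn ((encodeRow (G.game.owner k, List.ofFn (G.q k))).length + (G.n + 1))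
      (cfg .scan { par := p, chg := c } (encodeRow (G.game.owner k, List.ofFn (G.q k)) ++ a) b
        (markList G W p k) [])
      (cfg .scan { par := p, chg := c || (decide (Absorbed G W k) && !W k) } a
        ((encodeRow (G.game.owner k, List.ofFn (G.q k))).reverse ++ b)
        (markList G (mark G W k) p (k + 1)) []) := by
  have h1 : TM2.step program (cfg .scan { par := p, chg := c }
      (encodeRow (G.game.owner k, List.ofFn (G.q k)) ++ a) b (markList G W p k) []) =
      some (cfg .scan (rowReg G W p c k 0 false) ((List.ofFn (G.q k)).flatMap encodeRat ++ a)
        (.owner (G.game.owner k) :: b) (markList G W p k) []) := by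
    simp [program, encodeRow, Reg.read, rowReg]
  have h2 := reachesIn_fields G W p c k (G.n - 1) 0 (by have := k.2; omega) a
    (.owner (G.game.owner k) :: b) false
  have h3 := reachesIn_back (rowReg G W p c k G.n true) rfl (auxList G W p k).reverse a
    (((List.ofFn (G.q k)).flatMap encodeRat).reverse ++ .owner (G.game.owner k) :: b) []
  have h4 : (((auxList G W p k).reverse.map (rowReg G W p c k G.n true).update).reverse ++ []) =
      markList G (mark G W k) p (k + 1) := by
    rw [List.map_reverse, List.reverse_reverse, List.append_nil, auxList, markList, List.map_ofFn]
    congr 1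
    funext i
    simp only [Function.comp_apply, Reg.update, rowReg_new, mark, decide_eq_true_eq, ← Fin.ext_iff]
    by_cases h : i = k
    · subst h; simp [rowReg]
    · have h' : (i.1 < k.1 + 1) ↔ i.1 < k.1 := by
        have : i.1 ≠ k.1 := fun h' => h (Fin.ext h')
        omega
      simp [h, h']
  have h5 : ((auxList G W p k).reverse.any fun e =>
      e.2.2 && (rowReg G W p c k G.n true).new && !e.1) =
      (decide (Absorbed G W k) && !W k) := by
    rw [rowReg_new, List.any_reverse, Bool.eq_iff_iff]
    simp [auxList, List.any_eq_true, ← Fin.ext_iff, List.mem_ofFn]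
  rw [h4, h5] at h3
  have h6 := (ReachesIn.head h1 (h2.trans h3)).mono
    (t' := (encodeRow (G.game.owner k, List.ofFn (G.q k))).length + (G.n + 1))
    (by simp [encodeRow, auxList])
  simpa [encodeRow, rowReg] using h6

/-! ### Sweeps and the fixed point -/

theorem q_pos_iff (v w : Fin G.n) : 0 < G.q v w ↔ 0 < G.game.δ v w := by
  rw [← G.q_eq]
  exact Rat.cast_pos.symm

/-- No marked vertex belongs to a trap. -/
def Sound (W : Fin G.n → Bool) : Prop :=
  ∀ U, G.game.IsTrap U → ∀ v, W v = true → v ∉ U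

variable {G} {W : Fin G.n → Bool}

/-- Each way of being absorbed contradicts one clause of `IsTrap`: non-terminality, a successor kept
by Player 1, or closure at the other vertices. -/
theorem Sound.notMem_of_absorbed (hW : Sound G W) {k : Fin G.n} (hk : Absorbed G W k)
    {U : Set (Fin G.n)} (hU : G.game.IsTrap U) : k ∉ U := by
  intro hkU
  obtain ⟨hT, h1, h2⟩ := hU k hkU
  rcases hk with hk | hk
  · exact hT ((StochasticGame.mem_terminal_iff k).2 fun w hw => hk w ((q_pos_iff G k w).2 hw))
  · split_ifs at hk with ho
    · obtain ⟨w, hwU, hw⟩ := h1 ho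
      exact hW U hU w (hk w ((q_pos_iff G k w).2 hw)) hwU
    · obtain ⟨w, hw, hWw⟩ := hk
      exact hW U hU w hWw (h2 ho ((q_pos_iff G k w).1 hw))

theorem Sound.mark (hW : Sound G W) (k : Fin G.n) : Sound G (mark G W k) := by
  intro U hU v hv
  simp only [AttractorMachine.mark, Bool.or_eq_true, Bool.and_eq_true, decide_eq_true_eq] at hv
  rcases hv with hv | ⟨rfl, hv⟩
  · exact hW U hU v hv
  · exact hW.notMem_of_absorbed hv hU

theorem le_mark (k : Fin G.n) : W ≤ mark G W k := by
  intro i h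
  simp [mark, h]

theorem mark_eq_self {k : Fin G.n} (h : Absorbed G W k → W k = true) : mark G W k = W := by
  funext i
  by_cases hi : i = k
  · subst hi
    by_cases ha : Absorbed G W i <;> simp [mark, ha, h]
  · simp [mark, hi]

theorem rowsFrom_eq_append (k : Fin G.n) :
    rowsFrom G k = encodeRow (G.game.owner k, List.ofFn (G.q k)) ++ rowsFrom G (k + 1) := by
  rw [rowsFrom, drop_ofFn _ k.2]
  rfl

/-- New marks take effect within the same sweep. The flag `chg` never drops during it, so a final
`false` means that every row was tested against the same `W`, which is therefore closed on those
rows. -/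
theorem reachesIn_sweep (p : Bool) (d k : ℕ) (hk : k + d = G.n) (W : Fin G.n → Bool) (c : Bool) (b)
    (hW : Sound G W) :
    ∃ W' c', ReachesIn ((rowsFrom G k).length + d * (G.n + 1))
      (cfg .scan { par := p, chg := c } (rowsFrom G k) b (markList G W p k) [])
      (cfg .scan { par := p, chg := c' } [] ((rowsFrom G k).reverse ++ b) (markList G W' p G.n) [])
      ∧ Sound G W' ∧ W ≤ W' ∧ (c = true → c' = true) ∧
      (c' = false → W' = W ∧ ∀ i : Fin G.n, k ≤ i.1 → Absorbed G W i → W i = true) ∧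
      (c = false → c' = true → W' ≠ W) := by
  induction d generalizing k W c b with
  | zero =>
    obtain rfl : k = G.n := by omega
    have h : rowsFrom G G.n = [] := by
      rw [rowsFrom, List.drop_eq_nil_of_le (by simp), List.flatMap_nil]
    refine ⟨W, c, ?_, hW, le_rfl, id, fun _ => ⟨rfl, fun i hi => absurd i.2 (by omega)⟩, ?_⟩
    · rw [h]
      simpa using ReachesIn.refl _
    · rintro rfl h
      cases h
  | succ d ih =>
    obtain ⟨k, rfl⟩ : ∃ k' : Fin G.n, k'.1 = k := ⟨⟨k, by omega⟩, rfl⟩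
    have h1 := reachesIn_row G W p c k (rowsFrom G (k + 1)) b
    obtain ⟨W', c', h2, hs, hle, hc1, hc2, hc3⟩ := ih (k.1 + 1) (by omega) (mark G W k)
      (c || (decide (Absorbed G W k) && !W k))
      ((encodeRow (G.game.owner k, List.ofFn (G.q k))).reverse ++ b) (hW.mark k)
    refine ⟨W', c', ?_, hs, (le_mark k).trans hle, fun h => hc1 (by simp [h]), fun h => ?_,
      fun h h' => ?_⟩
    · rw [rowsFrom_eq_append k]
      have h3 := (h1.trans h2).mono (t' := (encodeRow (G.game.owner k, List.ofFn (G.q k)) ++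
        rowsFrom G (k + 1)).length + (d + 1) * (G.n + 1))
        (by rw [List.length_append, add_mul]; omega)
      simpa using h3
    · have h4 : Absorbed G W k → W k = true := by
        intro ha
        by_contra hWk
        have := hc1 (by simp [ha, hWk])
        simp [h] at this
      obtain ⟨h5, h6⟩ := hc2 h
      rw [mark_eq_self h4] at h5 h6
      refine ⟨h5, fun i hi => ?_⟩
      rcases Nat.lt_or_eq_of_le hi with hi | hi
      · exact h6 i hi
      · obtain rfl : k = i := Fin.ext hi
        exact h4
    · by_cases h4 : Absorbed G W k → W k = true
      · rw [mark_eq_self h4] at hc3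
        refine hc3 ?_ h'
        rw [h, Bool.false_or]
        by_cases ha : Absorbed G W k <;> simp [ha, h4]
      · rw [Classical.not_imp] at h4
        rintro rfl
        -- Row `k` acquired a mark that later rows cannot remove, so the result differs from the
        -- initial marking.
        exact h4.2 (hle k (by simp [mark, h4.1]))

theorem markList_eq_flip (p : Bool) : markList G W p G.n = markList G W (!p) 0 := by
  simp [markList]

theorem rowsFrom_zero : rowsFrom G 0 = G.encode := rfl

theorem reachesIn_round (W : Fin G.n → Bool) (p : Bool) (hW : Sound G W) :
    ∃ W' c', ReachesIn (2 * G.encode.length + G.n * (G.n + 1) + 2)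
      (cfg .rewind { par := p, chg := true } [] G.encode.reverse (markList G W p G.n) [])
      (cfg .rewind { par := !p, chg := c' } [] G.encode.reverse (markList G W' (!p) G.n) []) ∧
      Sound G W' ∧ W ≤ W' ∧
      (c' = false → W' = W ∧ ∀ i, Absorbed G W i → W i = true) ∧ (c' = true → W' ≠ W) := by
  have h1 := reachesIn_rewind { par := p, chg := true } rfl [] G.encode.reverse
    (markList G W p G.n)
  have h2 : TM2.step program (cfg .rewind { par := p, chg := true } G.encode []
      (markList G W p G.n) []) =
      some (cfg .scan { par := !p, chg := false } G.encode [] (markList G W (!p) 0) []) := by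
    simp [program, markList_eq_flip]
  obtain ⟨W', c', h3, hs, hle, -, hc1, hc2⟩ :=
    reachesIn_sweep (!p) G.n 0 (by omega) W false [] hW
  have h4 : TM2.step program (cfg .scan { par := !p, chg := c' } [] G.encode.reverse
      (markList G W' (!p) G.n) []) =
      some (cfg .rewind { par := !p, chg := c' } [] G.encode.reverse
        (markList G W' (!p) G.n) []) := by
    simp [program]
  rw [List.reverse_reverse, List.append_nil] at h1
  rw [rowsFrom_zero, List.append_nil] at h3
  refine ⟨W', c', (h1.trans (.head h2 (h3.trans (.of_step h4)))).mono ?_, hs, hle,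
    fun h => ⟨(hc1 h).1, fun i => (hc1 h).2 i (Nat.zero_le _)⟩, hc2 rfl⟩
  rw [List.length_reverse]
  omega

theorem reachesIn_stop (W : Fin G.n → Bool) (p : Bool) :
    ReachesIn (G.encode.length + 1)
      (cfg .rewind { par := p, chg := false } [] G.encode.reverse (markList G W p G.n) [])
      (cfg .clear { par := p } G.encode [] (markList G W p G.n) []) := by
  have h1 := reachesIn_rewind { par := p } rfl [] G.encode.reverse (markList G W p G.n)
  rw [List.reverse_reverse, List.append_nil, List.length_reverse] at h1
  exact h1.trans (.of_step (by simp [program]))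

theorem card_unmarked_lt {n : ℕ} {W W' : Fin n → Bool} (hle : W ≤ W') (hne : W' ≠ W) :
    (Finset.univ.filter fun i => W' i = false).card <
      (Finset.univ.filter fun i => W i = false).card := by
  refine Finset.card_lt_card (Finset.ssubset_iff_subset_ne.2 ⟨fun i hi => ?_, fun h => hne ?_⟩)
  · simp only [Finset.mem_filter, Finset.mem_univ, true_and] at hi ⊢
    have := hle i
    rw [hi] at this
    exact Bool.eq_false_of_le_false this
  · funext i
    have h1 := congrArg (i ∈ ·) h
    simp only [Finset.mem_filter, Finset.mem_univ, true_and, eq_iff_iff] at h1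
    cases h2 : W i <;> simp_all

/-- The bound `u` on the number of unmarked vertices drops with every sweep that changes something;
the extra round is the one that detects stability. -/
theorem reachesIn_loop (u : ℕ) (W : Fin G.n → Bool) (p : Bool) (hW : Sound G W)
    (hu : (Finset.univ.filter fun i => W i = false).card ≤ u) :
    ∃ W' p', ReachesIn ((u + 1) * (2 * G.encode.length + G.n * (G.n + 1) + 2) +
        (G.encode.length + 1))
      (cfg .rewind { par := p, chg := true } [] G.encode.reverse (markList G W p G.n) [])
      (cfg .clear { par := p' } G.encode [] (markList G W' p' G.n) []) ∧
      Sound G W' ∧ ∀ i, Absorbed G W' i → W' i = true := by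
  induction u generalizing W p with
  | zero =>
    obtain ⟨W', c', h1, hs, hle, hc1, hc2⟩ := reachesIn_round W p hW
    cases c' with
    | true => exact absurd (card_unmarked_lt hle (hc2 rfl)) (by omega)
    | false =>
      obtain ⟨rfl, hc⟩ := hc1 rfl
      exact ⟨W', !p, (h1.trans (reachesIn_stop W' (!p))).mono (by omega), hs, hc⟩
  | succ u ih =>
    obtain ⟨W', c', h1, hs, hle, hc1, hc2⟩ := reachesIn_round W p hW
    cases c' with
    | true =>
      have := card_unmarked_lt hle (hc2 rfl)
      obtain ⟨W'', p'', h2, h⟩ := ih W' (!p) hs (by omega)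
      refine ⟨W'', p'', (h1.trans h2).mono ?_, h⟩
      rw [add_mul (u + 1) 1]
      omega
    | false =>
      obtain ⟨rfl, hc⟩ := hc1 rfl
      refine ⟨W', !p, (h1.trans (reachesIn_stop W' (!p))).mono ?_, hs, hc⟩
      rw [add_mul (u + 1) 1]
      omega

/-! ### Output, correctness and running time -/

theorem reachesIn_clear (v : Reg) (a x) :
    ReachesIn (x.length + 1) (cfg .clear v a [] x [])
      (cfg .clearInput { v with last := true, ans := v.ans && x.all fun m => m.1 } a [] [] []) := by
  induction x generalizing v with
  | nil => exact .of_step (by simp [program])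
  | cons m x ih =>
    refine .head (c' := cfg .clear { v with last := false, ans := v.ans && m.1 } a [] x [])
      (by simp [program]) ?_
    simpa [Bool.and_assoc] using ih { v with last := false, ans := v.ans && m.1 }

theorem reachesIn_clearInput (v : Reg) (a) :
    ReachesIn (a.length + 1) (cfg .clearInput v a [] [] [])
      ⟨none, {}, tapes [] [] [] [] [v.ans]⟩ := by
  induction a generalizing v with
  | nil => exact .of_step (by simp [program])
  | cons s a ih =>
    refine .head (c' := cfg .clearInput { v with sym := some s } a [] [] [])
      (by simp [program]) ?_
    simpa using ih { v with sym := some s }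

theorem countP_isOwner_encode : G.encode.countP isOwner = G.n := by
  have hb : ∀ k, (encodeBinary k).countP isOwner = 0 := fun k => by
    simp [encodeBinary, List.countP_eq_zero, isOwner]
  have hr : ∀ l : List ℚ, (l.flatMap encodeRat).countP isOwner = 0 := fun l => by
    induction l with
    | nil => rfl
    | cons r l ih => simp [encodeRat, ih, hb, isOwner]
  have hrow : ∀ l : List (Owner × List ℚ), (l.flatMap encodeRow).countP isOwner = l.length :=
    fun l => by
      induction l with
      | nil => rfl
      | cons r l ih =>
        simp [encodeRow, ih, hr, List.countP_cons, isOwner]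
  simp [RationalGame.encode, hrow]

/-- Closure under `Absorbed` makes the unmarked vertices a trap, while soundness keeps every trap
inside them; so the unmarked set is the largest trap. -/
theorem stoppingUnderFairness_iff_forall (hs : Sound G W)
    (hc : ∀ i, Absorbed G W i → W i = true) :
    G.game.StoppingUnderFairness ↔ ∀ i, W i = true := by
  rw [StochasticGame.stoppingUnderFairness_iff]
  constructor
  · intro h
    have hU : G.game.IsTrap {v | W v = false} := by
      intro v hv
      have hna : ¬ Absorbed G W v := fun ha => by
        have := hc v ha
        rw [show W v = false from hv] at this
        cases this
      rw [Absorbed, not_or] at hna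
      refine ⟨fun hT => hna.1 fun w hw =>
        (StochasticGame.mem_terminal_iff v).1 hT w ((q_pos_iff G v w).1 hw), fun ho => ?_,
        fun ho w hw => ?_⟩
      · have h2 := hna.2
        rw [if_pos ho] at h2
        push Not at h2
        obtain ⟨w, hw, hWw⟩ := h2
        exact ⟨w, by simpa using hWw, (q_pos_iff G v w).1 hw⟩
      · have h2 := hna.2
        rw [if_neg ho] at h2
        push Not at h2
        simpa using h2 w ((q_pos_iff G v w).2 hw)
    intro i
    by_contra hi
    have : i ∈ {v | W v = false} := by simpa using hi
    rw [h _ hU] at this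
    exact this
  · intro h U hU
    exact Set.eq_empty_of_forall_notMem fun v => hs U hU v (h v)

/-- The program as a bundled Turing machine. -/
noncomputable def machine : FinTM2 where
  K := Stack
  k₀ := .inp
  k₁ := .out
  Γ := Alphabet
  Λ := Label
  main := .count
  σ := Reg
  initialState := {}
  m := program

theorem initList_machine (w : List GameSymbol) :
    initList machine (w.map (Equiv.refl GameSymbol).invFun) = cfg .count {} w [] [] [] := by
  unfold initList
  congr 1
  funext k
  cases k
  case inp => exact List.map_id w
  all_goals rfl

theorem haltList_machine (l : List Bool) :
    haltList machine (l.map (Equiv.refl Bool).invFun) = ⟨none, {}, tapes [] [] [] [] l⟩ := by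
  unfold haltList
  congr 1
  funext k
  cases k
  case out => exact List.map_id l
  all_goals rfl

/-- A bound for the running time. -/
noncomputable def runningTime : Polynomial ℕ :=
  (.X + 1) * (2 * .X + .X * (.X + 1) + 2) + 4 * .X + 4

theorem length_le_encode : G.n ≤ G.encode.length := by
  rw [← countP_isOwner_encode]
  exact List.countP_le_length

theorem reachesIn_result (b : Bool) (hb : b = true ↔ G.game.StoppingUnderFairness) :
    ReachesIn (runningTime.eval G.encode.length) (cfg .count {} G.encode [] [] [])
      ⟨none, {}, tapes [] [] [] [] [b]⟩ := by
  have h1 := reachesIn_count G.encode [] []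
  -- The initial tags look like those left by a completed sweep of parity `false`, so the loop
  -- starts as after any other sweep.
  have hm : List.replicate G.n (false, false) ++ [] = markList G (fun _ => false) false G.n := by
    simp [markList, List.ofFn_const]
  rw [countP_isOwner_encode, hm, List.append_nil] at h1
  obtain ⟨W, p, h2, hs, hc⟩ := reachesIn_loop G.n (fun _ : Fin G.n => false) false
    (fun U _ v h => by cases h) (by simp)
  have h3 := reachesIn_clear { par := p } G.encode (markList G W p G.n)
  have h4 := reachesIn_clearInput
    { par := p, last := true, ans := true && (markList G W p G.n).all fun m => m.1 } G.encode
  have hans : (true && (markList G W p G.n).all fun m => m.1) = b := by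
    rw [Bool.eq_iff_iff, hb, stoppingUnderFairness_iff_forall hs hc]
    simp [markList, List.all_eq_true, List.mem_ofFn]
  have h5 := ((h1.trans h2).trans h3).trans h4
  rw [hans] at h5
  refine h5.mono ?_
  have hn := length_le_encode (G := G)
  have h6 : (G.n + 1) * (2 * G.encode.length + G.n * (G.n + 1) + 2) ≤
      (G.encode.length + 1) *
        (2 * G.encode.length + G.encode.length * (G.encode.length + 1) + 2) := by gcongr
  have h7 : (markList G W p G.n).length = G.n := by simp [markList]
  simp only [runningTime, Polynomial.eval_add, Polynomial.eval_mul, Polynomial.eval_X,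
    Polynomial.eval_one, Polynomial.eval_ofNat]
  omega

open Classical in
/-- The machine decides in polynomial time whether a game is stopping under fairness. -/
noncomputable def computable : TM2ComputableInPolyTime RationalGame.encode Computability.encodeBool
    (fun G : RationalGame => decide G.game.StoppingUnderFairness) where
  tm := machine
  inputAlphabet := Equiv.refl _
  outputAlphabet := Equiv.refl _
  time := runningTime
  outputsFun G := by
    have h := reachesIn_result (G := G) _ decide_eq_true_iff
    have h1 : (flip bind machine.step)^[h.choose] (some (initList machine
        (G.encode.map (Equiv.refl GameSymbol).invFun))) = some (haltList machine
        ([decide G.game.StoppingUnderFairness].map (Equiv.refl Bool).invFun)) :=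
      (congrArg (fun c => (flip bind machine.step)^[h.choose] (some c))
        (initList_machine G.encode)).trans
          (h.choose_spec.2.trans (congrArg some (haltList_machine _).symm))
    exact ⟨⟨h.choose, h1⟩, h.choose_spec.1⟩

end AttractorMachine

theorem mainTheorem5 :
    DecidableInPolyTime RationalGame.encode
      (fun G : RationalGame => G.game.StoppingUnderFairness) := by
  classical
  exact ⟨_, fun _ => decide_eq_true_iff, AttractorMachine.computable,
    fun k => @Finite.of_fintype _ (AttractorMachine.fintypeAlphabet k)⟩
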